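/- Let $m>2$ be an integer, let $D$ and $Q$ be the dihedral group and the generalized quaternion group of order $2^m$, respectively, let $E$ be a finite elementary abelian $2$-group (possibly trivial), and let $F$ be a finite field of characteristic two. For a finite group $G$ put $G_T=\{g\in G \mid g^2=1\}$ (so $1\in G_T$), and let $*$ be the classical involution of the group algebra $FG$, that is, $\bigl(\sum_{g\in G}\alpha_g g\bigr)^*=\sum_{g\in G}\alpha_g g^{-1}$. Let $V_*(FG)$ be the group of all units $u=\sum_{g\in G}\alpha_g g$ of $FG$ with $\sum_{g\in G}\alpha_g=1$ and $u^*=u^{-1}$. Then $$|V_*(FG)|=n\cdot |F|^{\frac12(|G|+|G_T|)-1},$$ where $n=1$ if $G=D\times E$, and $n=4$ if $G=Q\times E$. -/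

import Mathlib

namespace UnitaryGroupAlgebra

section

variable (F : Type*) [Field F] (G : Type*) [Group G]

/-- The augmentation map `χ : FG → F`, `∑ α_g g ↦ ∑ α_g`. -/
noncomputable def augmentation : MonoidAlgebra F G →ₐ[F] F :=
  MonoidAlgebra.lift F F G 1

/-- The group `V(FG)` of normalized units: the units of `FG` of augmentation `1`. -/
noncomputable def normalizedUnits : Subgroup (MonoidAlgebra F G)ˣ :=
  (Units.map (augmentation F G : MonoidAlgebra F G →* F)).ker

variable {F G}

/-- The classical involution `*` of `FG`: the linear extension of `g ↦ g⁻¹`, that is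
`(∑ α_g g)* = ∑ α_g g⁻¹`. -/
noncomputable def involution (x : MonoidAlgebra F G) : MonoidAlgebra F G :=
  MonoidAlgebra.mapDomain (fun g : G => g⁻¹) x

theorem involution_single (g : G) (a : F) :
    involution (MonoidAlgebra.single g a) = MonoidAlgebra.single g⁻¹ a :=
  MonoidAlgebra.mapDomain_single

theorem involution_add (x y : MonoidAlgebra F G) :
    involution (x + y) = involution x + involution y :=
  MonoidAlgebra.mapDomain_add _ x y

theorem involution_zero : involution (0 : MonoidAlgebra F G) = 0 :=
  MonoidAlgebra.mapDomain_zero _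

theorem involution_one : involution (1 : MonoidAlgebra F G) = 1 := by
  rw [MonoidAlgebra.one_def, involution_single, inv_one]

theorem involution_mul (x y : MonoidAlgebra F G) :
    involution (x * y) = involution y * involution x := by
  induction x using MonoidAlgebra.induction_linear with
  | zero => simp [involution_zero]
  | add p q hp hq => rw [add_mul, involution_add, hp, hq, involution_add, mul_add]
  | single g a =>
    induction y using MonoidAlgebra.induction_linear with
    | zero => simp [involution_zero]
    | add p q hp hq => rw [mul_add, involution_add, hp, hq, involution_add, add_mul]
    | single h b =>
      simp only [involution_single, MonoidAlgebra.single_mul_single, mul_inv_rev, mul_comm a b]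

variable (F G)

/-- The `*`-unitary subgroup `V_*(FG)`: all normalized units `u` of `FG` with `u* = u⁻¹`. -/
noncomputable def unitarySubgroup : Subgroup (MonoidAlgebra F G)ˣ where
  carrier := {u | u ∈ normalizedUnits F G ∧
    involution (u : MonoidAlgebra F G) = ((u⁻¹ : (MonoidAlgebra F G)ˣ) : MonoidAlgebra F G)}
  one_mem' := ⟨one_mem _, by simp [involution_one]⟩
  mul_mem' := by
    rintro u v ⟨hu, hu'⟩ ⟨hv, hv'⟩
    exact ⟨mul_mem hu hv, by rw [Units.val_mul, involution_mul, hu', hv', mul_inv_rev, Units.val_mul]⟩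
  inv_mem' := by
    rintro u ⟨hu, hu'⟩
    refine ⟨inv_mem hu, ?_⟩
    have h : involution ((u⁻¹ : (MonoidAlgebra F G)ˣ) : MonoidAlgebra F G) *
        ((u⁻¹ : (MonoidAlgebra F G)ˣ) : MonoidAlgebra F G) = 1 := by
      conv_lhs => rw [← hu', ← involution_mul, hu', u.mul_inv, involution_one]
    rw [inv_inv]
    exact (Units.mul_inv_eq_one.mp h)

end

/-- The set `G_T = {g ∈ G | g ^ 2 = 1}`; it contains the identity. -/
def involutionSet (G : Type*) [Group G] : Set G := {g | g ^ 2 = 1}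

end UnitaryGroupAlgebra

namespace UnitaryGroupAlgebra

open MonoidAlgebra

section Involutive

variable {X : Type*} {τ : X → X}

theorem exists_add_comp_of_comp_eq {M : Type*} [AddMonoid M] (hτ : Function.Involutive τ)
    {f : X → M} (hf : ∀ x, f (τ x) = f x) (h0 : ∀ x, τ x = x → f x = 0) :
    ∃ t : X → M, ∀ x, f x = t x + t (τ x) := by
  classical
  let : LinearOrder X := IsWellOrder.linearOrder WellOrderingRel
  refine ⟨fun x => if x < τ x then f x else 0, fun x => ?_⟩
  rcases lt_trichotomy x (τ x) with h | h | h
  · simp [h, hτ x, h.not_gt]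
  · simp [← h, h0 x h.symm]
  · simp [h, hτ x, h.not_gt, hf x]

theorem card_invariant_functions [Finite X] (M : Type*) (hτ : Function.Involutive τ) :
    ∃ n, Nat.card X = 2 * n + Nat.card {x // τ x = x} ∧
      Nat.card {f : X → M // ∀ x, f (τ x) = f x} =
        Nat.card M ^ (n + Nat.card {x // τ x = x}) := by
  classical
  let : LinearOrder X := IsWellOrder.linearOrder WellOrderingRel
  have := Fintype.ofFinite X
  have hgt : Nat.card {x // τ x < x} = Nat.card {x // x < τ x} :=
    Nat.card_congr
      { toFun := fun x => ⟨τ x, by simpa [hτ x.1] using x.2⟩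
        invFun := fun x => ⟨τ x, by simpa [hτ x.1] using x.2⟩
        left_inv := fun x => by simp [hτ x.1]
        right_inv := fun x => by simp [hτ x.1] }
  have hle : Nat.card {x // x ≤ τ x} = Nat.card {x // x < τ x} + Nat.card {x // τ x = x} := by
    simp only [Nat.card_eq_fintype_card, Fintype.card_subtype]
    rw [← Finset.card_union_of_disjoint]
    · congr 1
      ext x
      simp [le_iff_lt_or_eq, eq_comm]
    · rw [Finset.disjoint_filter]
      exact fun x _ h h' => h.ne' h'
  have htot : Nat.card X = Nat.card {x // x ≤ τ x} + Nat.card {x // τ x < x} := by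
    simp only [Nat.card_eq_fintype_card, Fintype.card_subtype]
    rw [← Finset.card_union_of_disjoint]
    · rw [← Finset.card_univ]
      congr 1
      ext x
      simp [le_or_gt]
    · rw [Finset.disjoint_filter]
      exact fun x _ h h' => h.not_gt h'
  refine ⟨Nat.card {x // x < τ x}, by omega, ?_⟩
  rw [← hle, ← Nat.card_fun]
  refine Nat.card_congr
    { toFun := fun f x => f.1 x.1
      invFun := fun g => ⟨fun x => if h : x ≤ τ x then g ⟨x, h⟩ else
        g ⟨τ x, by rw [hτ x]; exact (not_le.1 h).le⟩, fun x => ?_⟩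
      left_inv := fun f => ?_
      right_inv := fun g => ?_ }
  · rcases lt_trichotomy x (τ x) with h | h | h
    · simp [h.le, hτ x, h.not_ge]
    · simp [← h]
    · simp [h.le, hτ x, h.not_ge]
  · ext x
    by_cases h : x ≤ τ x
    · simp [h]
    · simp [h, f.2]
  · ext x
    simp [x.2]

end Involutive

section Coefficients

variable {F : Type*} [Field F] {G : Type*} [Group G]

instance [Finite F] [Finite G] : Finite (MonoidAlgebra F G) :=
  Finite.of_equiv (G → F) (Finsupp.equivFunOnFinite.symm.trans coeffEquiv.symm)

omit [Group G] in
theorem card_monoidAlgebra [Finite G] : Nat.card (MonoidAlgebra F G) = Nat.card F ^ Nat.card G := by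
  rw [← Nat.card_fun]
  exact Nat.card_congr (coeffEquiv.trans Finsupp.equivFunOnFinite)

theorem coeff_involution (x : MonoidAlgebra F G) (g : G) :
    (involution x).coeff g = x.coeff g⁻¹ := by
  have := Finsupp.mapDomain_apply (inv_injective (G := G)) x.coeff g⁻¹
  rwa [inv_inv] at this

theorem involution_involution (x : MonoidAlgebra F G) : involution (involution x) = x := by
  ext g
  simp [coeff_involution]

theorem augmentation_single (g : G) (a : F) : augmentation F G (single g a) = a := by
  simp [augmentation]

theorem augmentation_involution (x : MonoidAlgebra F G) :
    augmentation F G (involution x) = augmentation F G x := by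
  induction x using MonoidAlgebra.induction_linear with
  | zero => simp [involution_zero]
  | add p q hp hq => rw [involution_add, map_add, map_add, hp, hq]
  | single g a => rw [involution_single, augmentation_single, augmentation_single]

variable (F G)

/-- The additive map `x ↦ x + x*`. -/
noncomputable def trace : MonoidAlgebra F G →+ MonoidAlgebra F G where
  toFun x := x + involution x
  map_zero' := by simp [involution_zero]
  map_add' x y := by rw [involution_add]; abel

variable {F G}

theorem trace_apply (x : MonoidAlgebra F G) : trace F G x = x + involution x := rfl

theorem involution_trace (x : MonoidAlgebra F G) : involution (trace F G x) = trace F G x := by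
  rw [trace_apply, involution_add, involution_involution, add_comm]

omit [Group G] in
theorem exists_of_coeff [Finite G] (f : G → F) : ∃ x : MonoidAlgebra F G, ∀ g, x.coeff g = f g :=
  ⟨ofCoeff (Finsupp.equivFunOnFinite.symm f), fun g => by simp⟩

theorem exists_trace_eq [Finite G] {x : MonoidAlgebra F G} (hx : involution x = x)
    (h0 : ∀ g : G, g ^ 2 = 1 → x.coeff g = 0) : ∃ t, x = trace F G t := by
  obtain ⟨t, ht⟩ := exists_add_comp_of_comp_eq (τ := fun g : G => g⁻¹) (f := fun g => x.coeff g)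
    inv_inv (fun g => by rw [← coeff_involution, hx])
    (fun g hg => h0 g (by rw [sq]; nth_rw 1 [← hg]; simp))
  obtain ⟨y, hy⟩ := exists_of_coeff t
  refine ⟨y, ?_⟩
  ext g
  simp [trace_apply, coeff_involution, ht, hy]

theorem inv_eq_iff_sq {g : G} : g⁻¹ = g ↔ g ^ 2 = 1 := by
  rw [sq, inv_eq_iff_mul_eq_one]

variable [CharP F 2]

instance charTwo_monoidAlgebra : CharP (MonoidAlgebra F G) 2 :=
  charP_of_injective_algebraMap (algebraMap F (MonoidAlgebra F G)).injective 2

theorem trace_eq_zero_iff {x : MonoidAlgebra F G} : trace F G x = 0 ↔ involution x = x := by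
  rw [trace_apply, CharTwo.add_eq_zero, eq_comm]

theorem trace_single_of_sq {g : G} (hg : g ^ 2 = 1) (a : F) : trace F G (single g a) = 0 := by
  rw [trace_eq_zero_iff, involution_single, inv_eq_iff_sq.2 hg]

/-- An additive submonoid containing all traces and all multiples of elements of order at most
two contains every `*`-symmetric element. -/
theorem mem_of_involution_eq [Finite G] (H : AddSubmonoid (MonoidAlgebra F G))
    (hT : ∀ t, trace F G t ∈ H) (hS : ∀ (g : G) (a : F), g ^ 2 = 1 → single g a ∈ H)
    {x : MonoidAlgebra F G} (hx : involution x = x) : x ∈ H := by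
  classical
  have := Fintype.ofFinite G
  set r : MonoidAlgebra F G := ∑ g ∈ Finset.univ.filter (fun g : G => g ^ 2 = 1),
    single g (x.coeff g) with hr
  have hrH : r ∈ H := sum_mem fun g hg => hS g _ (by simpa using hg)
  have hri : involution r = r := by
    rw [← trace_eq_zero_iff, hr, map_sum]
    exact Finset.sum_eq_zero fun g hg => trace_single_of_sq (by simpa using hg) _
  obtain ⟨t, ht⟩ := exists_trace_eq (x := x + r) (by rw [involution_add, hx, hri]) (by
    intro g hg
    have : r.coeff g = x.coeff g := by
      rw [hr, coeff_sum, Finsupp.finsetSum_apply,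
        Finset.sum_eq_single_of_mem g (by simpa using hg)]
      · simp
      · intro h _ hne
        simp [hne]
    rw [coeff_add, Finsupp.add_apply, this, CharTwo.add_self_eq_zero])
  have : x = trace F G t + r := by
    rw [← ht, add_assoc, CharTwo.add_self_eq_zero, add_zero]
  rw [this]
  exact H.add_mem (hT t) hrH

variable (F G) in
theorem card_ker_trace [Finite G] :
    ∃ n, Nat.card G = 2 * n + Nat.card (involutionSet G) ∧
      Nat.card (trace F G).ker = Nat.card F ^ (n + Nat.card (involutionSet G)) := by
  obtain ⟨n, h1, h2⟩ := card_invariant_functions (τ := fun g : G => g⁻¹) F inv_inv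
  have hT : Nat.card {g : G // g⁻¹ = g} = Nat.card (involutionSet G) :=
    Nat.card_congr (Equiv.subtypeEquivRight fun g => inv_eq_iff_sq)
  refine ⟨n, by rw [h1, hT], ?_⟩
  rw [← hT, ← h2]
  refine Nat.card_congr (Equiv.subtypeEquiv (coeffEquiv.trans Finsupp.equivFunOnFinite) fun x => ?_)
  rw [AddMonoidHom.mem_ker, trace_eq_zero_iff, MonoidAlgebra.ext_iff, Finsupp.ext_iff]
  simp [coeff_involution]

/-- `x x*` differs from `χ(x)²` by a trace. -/
theorem exists_mul_involution_eq (x : MonoidAlgebra F G) :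
    ∃ t, x * involution x = algebraMap F _ (augmentation F G x ^ 2) + trace F G t := by
  induction x using MonoidAlgebra.induction_linear with
  | zero => exact ⟨0, by simp⟩
  | add p q hp hq =>
    obtain ⟨s, hs⟩ := hp
    obtain ⟨t, ht⟩ := hq
    refine ⟨s + t + p * involution q, ?_⟩
    rw [involution_add, mul_add, add_mul, add_mul, hs, ht, map_add, map_add, map_add,
      CharTwo.add_sq, map_add, trace_apply (p * _), involution_mul, involution_involution]
    abel
  | single g a =>
    exact ⟨0, by
      simp [involution_single, single_mul_single, augmentation_single, sq]⟩

end Coefficients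

@[to_additive card_map_mul_card_inf_ker']
theorem card_map_mul_card_inf_ker {G H : Type*} [Group G] [Group H] (f : G →* H)
    (K : Subgroup G) :
    Nat.card (K.map f) * Nat.card (K ⊓ f.ker : Subgroup G) = Nat.card K := by
  rw [← Subgroup.relIndex_ker, ← Subgroup.inf_relIndex_left, mul_comm,
    ← Subgroup.relIndex_bot_left, ← Subgroup.relIndex_bot_left]
  exact Subgroup.relIndex_mul_relIndex _ _ _ bot_le inf_le_left

section Augmentation

variable {F : Type*} [Field F] {G : Type*} [Group G]

theorem mem_normalizedUnits {u : (MonoidAlgebra F G)ˣ} :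
    u ∈ normalizedUnits F G ↔ augmentation F G u = 1 := by
  rw [normalizedUnits, MonoidHom.mem_ker, Units.ext_iff]
  rfl

theorem mem_unitarySubgroup {u : (MonoidAlgebra F G)ˣ} :
    u ∈ unitarySubgroup F G ↔ augmentation F G u = 1 ∧
      (u : MonoidAlgebra F G) * involution (u : MonoidAlgebra F G) = 1 := by
  rw [← mem_normalizedUnits, Units.mul_eq_one_iff_inv_eq,
    eq_comm (a := ((u⁻¹ : _ˣ) : MonoidAlgebra F G))]
  rfl

theorem card_augmentation_eq_one [Finite F] [Finite G] :
    Nat.card F * Nat.card {x : MonoidAlgebra F G // augmentation F G x = 1} =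
      Nat.card (MonoidAlgebra F G) := by
  have h := card_map_mul_card_inf_ker' (augmentation F G).toRingHom.toAddMonoidHom ⊤
  have hs : Function.Surjective (augmentation F G).toRingHom.toAddMonoidHom :=
    fun a => ⟨single 1 a, augmentation_single 1 a⟩
  rw [AddSubgroup.map_top_of_surjective _ hs, top_inf_eq, AddSubgroup.card_top,
    AddSubgroup.card_top] at h
  rw [← h]
  congr 1
  refine Nat.card_congr ((Equiv.addRight (-1)).subtypeEquiv fun x => ?_)
  change _ ↔ augmentation F G (x + -1) = 0
  rw [map_add, map_neg, map_one, ← sub_eq_add_neg, sub_eq_zero]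

/-- A unitary normalized unit of a finite group algebra is an element `x` with `χ(x) = 1` and
`x x* = 1`. -/
theorem card_unitarySubgroup_eq [Finite F] [Finite G] :
    Nat.card (unitarySubgroup F G) =
      Nat.card {x : MonoidAlgebra F G // augmentation F G x = 1 ∧ x * involution x = 1} := by
  refine Nat.card_congr
    { toFun := fun u => ⟨u.1, mem_unitarySubgroup.1 u.2⟩
      invFun := fun x => ⟨⟨x.1, involution x.1, x.2.2, mul_eq_one_symm x.2.2⟩,
        mem_unitarySubgroup.2 x.2⟩
      left_inv := fun u => by ext; rfl
      right_inv := fun x => rfl }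

theorem coeff_one_add_single_mul (c : G) (x : MonoidAlgebra F G) (g : G) :
    ((1 + single c 1) * x).coeff g = x.coeff g + x.coeff (c⁻¹ * g) := by
  rw [add_mul, one_mul, coeff_add, Finsupp.add_apply, coeff_single_mul_apply, one_mul]

variable [CharP F 2] {c : G}

theorem coeff_of_one_add_single_mul_eq_zero {x : MonoidAlgebra F G} :
    (1 + single c 1) * x = 0 ↔ ∀ g, x.coeff (c⁻¹ * g) = x.coeff g := by
  rw [MonoidAlgebra.ext_iff, Finsupp.ext_iff]
  refine forall_congr' fun g => ?_
  rw [coeff_one_add_single_mul, coeff_zero, Finsupp.zero_apply, CharTwo.add_eq_zero, eq_comm]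

theorem involutive_inv_mul (hc : c ^ 2 = 1) : Function.Involutive fun g : G => c⁻¹ * g := by
  intro g
  change c⁻¹ * (c⁻¹ * g) = g
  rw [← mul_assoc, ← mul_inv_rev, ← sq, hc, inv_one, one_mul]

theorem one_add_single_sq (hc : c ^ 2 = 1) :
    (1 + single c 1 : MonoidAlgebra F G) * (1 + single c 1) = 0 := by
  rw [mul_add, mul_one, add_mul, one_mul, single_mul_single, ← sq, hc, one_mul, ← one_def,
    add_comm 1 (single c 1), CharTwo.add_self_eq_zero]

theorem exists_of_one_add_single_mul_eq_zero [Finite G] (hc : c ^ 2 = 1) (hc1 : c ≠ 1)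
    {x : MonoidAlgebra F G} (hx : (1 + single c 1) * x = 0) :
    ∃ t, x = (1 + single c 1) * t := by
  obtain ⟨t, ht⟩ := exists_add_comp_of_comp_eq (involutive_inv_mul hc)
    (coeff_of_one_add_single_mul_eq_zero.1 hx) (fun g hg => absurd hg (by simpa using hc1))
  obtain ⟨y, hy⟩ := exists_of_coeff t
  refine ⟨y, ?_⟩
  ext g
  rw [coeff_one_add_single_mul, ht, hy, hy]

theorem card_one_add_single_mul_eq_zero [Finite G] (hc : c ^ 2 = 1) (hc1 : c ≠ 1) :
    ∃ n, Nat.card G = 2 * n ∧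
      Nat.card {x : MonoidAlgebra F G // (1 + single c 1) * x = 0} = Nat.card F ^ n := by
  obtain ⟨n, h1, h2⟩ := card_invariant_functions F (involutive_inv_mul hc)
  have : IsEmpty {x : G // c⁻¹ * x = x} := ⟨fun x => hc1 (by simpa using x.2)⟩
  rw [Nat.card_of_isEmpty (α := {x : G // c⁻¹ * x = x}), add_zero] at h1 h2
  refine ⟨n, h1, ?_⟩
  rw [← h2]
  exact Nat.card_congr (Equiv.subtypeEquiv (coeffEquiv.trans Finsupp.equivFunOnFinite)
    fun x => by rw [coeff_of_one_add_single_mul_eq_zero]; rfl)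

end Augmentation

section Commutative

variable {F : Type*} [Field F] {A : Type*} [CommGroup A]

theorem exists_pow_eq_augmentation [CharP F 2] [Finite A] (hA : IsPGroup 2 A) :
    ∃ j, ∀ x : MonoidAlgebra F A, x ^ 2 ^ j = algebraMap F _ (augmentation F A x ^ 2 ^ j) := by
  have : Fact (Nat.Prime 2) := ⟨Nat.prime_two⟩
  obtain ⟨j, hj⟩ := IsPGroup.iff_card.1 hA
  refine ⟨j, fun x => ?_⟩
  induction x using MonoidAlgebra.induction_linear with
  | zero => simp
  | add p q hp hq => rw [map_add, add_pow_char_pow, add_pow_char_pow, map_add, hp, hq]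
  | single g a =>
    rw [single_pow, ← hj, pow_card_eq_one', augmentation_single]
    simp

theorem isUnit_of_augmentation_ne_zero [CharP F 2] [Finite A] (hA : IsPGroup 2 A)
    {x : MonoidAlgebra F A} (hx : augmentation F A x ≠ 0) : IsUnit x := by
  obtain ⟨j, hj⟩ := exists_pow_eq_augmentation (F := F) hA
  refine isUnit_pow_iff (n := 2 ^ j) (by positivity) |>.1 ?_
  rw [hj]
  exact (IsUnit.mk0 _ (pow_ne_zero _ hx)).map _

variable (F A) in
/-- The involution of a commutative group algebra as a ring homomorphism. -/
noncomputable def involutionHom : MonoidAlgebra F A →+* MonoidAlgebra F A where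
  toFun := involution
  map_one' := involution_one
  map_zero' := involution_zero
  map_add' := involution_add
  map_mul' x y := by rw [involution_mul, mul_comm]

variable (F A) in
/-- The norm map `u ↦ u u*` on the units of a commutative group algebra. -/
noncomputable def unitNorm : (MonoidAlgebra F A)ˣ →* (MonoidAlgebra F A)ˣ :=
  MonoidHom.id _ * Units.map (involutionHom F A : MonoidAlgebra F A →* MonoidAlgebra F A)

theorem val_unitNorm (u : (MonoidAlgebra F A)ˣ) :
    (unitNorm F A u : MonoidAlgebra F A) = u * involution (u : MonoidAlgebra F A) := rfl

theorem unitarySubgroup_eq_inf : unitarySubgroup F A = normalizedUnits F A ⊓ (unitNorm F A).ker := by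
  ext u
  rw [mem_unitarySubgroup, Subgroup.mem_inf, mem_normalizedUnits, MonoidHom.mem_ker,
    Units.ext_iff, val_unitNorm, Units.val_one]

variable (F A) in
/-- The group of the norms `u u*` of the normalized units. -/
noncomputable def normSubgroup : Subgroup (MonoidAlgebra F A)ˣ :=
  (normalizedUnits F A).map (unitNorm F A)

theorem mem_normSubgroup {v : (MonoidAlgebra F A)ˣ} :
    v ∈ normSubgroup F A ↔ ∃ u : (MonoidAlgebra F A)ˣ, augmentation F A u = 1 ∧
      (u : MonoidAlgebra F A) * involution (u : MonoidAlgebra F A) = v := by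
  simp only [normSubgroup, Subgroup.mem_map, mem_normalizedUnits, Units.ext_iff, val_unitNorm]

variable [CharP F 2] [Finite F] [Finite A]

theorem card_normalizedUnits (hA : IsPGroup 2 A) :
    Nat.card F * Nat.card (normalizedUnits F A) = Nat.card (MonoidAlgebra F A) := by
  rw [← card_augmentation_eq_one]
  congr 1
  refine Nat.card_congr (Equiv.ofBijective
    (fun u => ⟨u.1, mem_normalizedUnits.1 u.2⟩) ⟨fun u v h => ?_, fun x => ?_⟩)
  · exact Subtype.ext (Units.ext (congrArg Subtype.val h))
  · obtain ⟨u, hu⟩ := isUnit_of_augmentation_ne_zero hA (x := x.1) (by simp [x.2])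
    exact ⟨⟨u, mem_normalizedUnits.2 (by rw [hu, x.2])⟩, Subtype.ext hu⟩

/-- The order of the unitary subgroup is governed by the index of the group of norms in the
group of all elements `1 + (t + t*)`. -/
theorem two_mul_card_normSubgroup_iff (hA : IsPGroup 2 A) :
    2 * Nat.card (normSubgroup F A) = Nat.card (trace F A).range ↔
      Nat.card F * Nat.card (unitarySubgroup F A) = 2 * Nat.card (trace F A).ker := by
  have h1 := card_map_mul_card_inf_ker (unitNorm F A) (normalizedUnits F A)
  rw [← unitarySubgroup_eq_inf] at h1
  change Nat.card (normSubgroup F A) * _ = _ at h1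
  have h2 := card_map_mul_card_inf_ker' (trace F A) ⊤
  rw [top_inf_eq, AddSubgroup.card_top, ← AddMonoidHom.range_eq_map] at h2
  have h3 := card_normalizedUnits (F := F) hA
  rw [← h1, ← h2] at h3
  have hN : 0 < Nat.card (normSubgroup F A) := Nat.card_pos
  have hK : 0 < Nat.card (trace F A).ker := Nat.card_pos
  generalize Nat.card (normSubgroup F A) = N at *
  generalize Nat.card (unitarySubgroup F A) = U at *
  generalize Nat.card (trace F A).range = T at *
  generalize Nat.card (trace F A).ker = K at *
  constructor
  · rintro rfl
    apply Nat.eq_of_mul_eq_mul_left hN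
    linarith
  · intro h
    apply Nat.eq_of_mul_eq_mul_right hK
    rw [← h3, mul_right_comm, ← h]
    ring

end Commutative

section Norms

variable {F : Type*} [Field F] {A : Type*} [CommGroup A]

/-- `y` is the norm `x x*` of an element `x` of augmentation one. -/
def IsUnitNorm (y : MonoidAlgebra F A) : Prop :=
  ∃ x, augmentation F A x = 1 ∧ x * involution x = y

theorem IsUnitNorm.one : IsUnitNorm (1 : MonoidAlgebra F A) :=
  ⟨1, map_one _, by rw [involution_one, one_mul]⟩

theorem IsUnitNorm.mul {x y : MonoidAlgebra F A} (hx : IsUnitNorm x) (hy : IsUnitNorm y) :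
    IsUnitNorm (x * y) := by
  obtain ⟨u, hu, rfl⟩ := hx
  obtain ⟨v, hv, rfl⟩ := hy
  exact ⟨u * v, by rw [map_mul, hu, hv, one_mul], by rw [involution_mul]; ring⟩

theorem mem_normSubgroup_iff_isUnitNorm [CharP F 2] [Finite A] (hA : IsPGroup 2 A)
    {v : (MonoidAlgebra F A)ˣ} :
    v ∈ normSubgroup F A ↔ IsUnitNorm (v : MonoidAlgebra F A) := by
  rw [mem_normSubgroup]
  constructor
  · rintro ⟨u, h⟩
    exact ⟨u, h⟩
  · rintro ⟨x, hx, h⟩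
    obtain ⟨u, rfl⟩ := isUnit_of_augmentation_ne_zero hA (x := x) (by simp [hx])
    exact ⟨u, hx, h⟩

variable {c : A}

theorem involution_one_add_single (hc : c ^ 2 = 1) :
    involution (1 + single c 1 : MonoidAlgebra F A) = 1 + single c 1 := by
  rw [involution_add, involution_one, involution_single, inv_eq_iff_sq.2 hc]

theorem trace_one_add_single_mul (hc : c ^ 2 = 1) (q : MonoidAlgebra F A) :
    trace F A ((1 + single c 1) * q) = (1 + single c 1) * trace F A q := by
  rw [trace_apply, trace_apply, involution_mul, involution_one_add_single hc]
  ring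

variable [CharP F 2]

theorem isUnitNorm_one_add_single_mul_trace (hc : c ^ 2 = 1) (q : MonoidAlgebra F A) :
    IsUnitNorm (1 + (1 + single c 1) * trace F A q) := by
  refine ⟨1 + (1 + single c 1) * q, ?_, ?_⟩
  · rw [map_add, map_mul, map_add, map_one, augmentation_single, CharTwo.add_self_eq_zero,
      zero_mul, add_zero]
  · rw [involution_add, involution_mul, involution_one_add_single hc, involution_one, trace_apply]
    linear_combination (q * involution q) * one_add_single_sq (F := F) hc

/-- If `c` is a fourth power, then `1 + a(g + g⁻¹)` is a norm for every square root `g` of `c`. -/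
theorem isUnitNorm_one_add_trace_single (hc : c ^ 2 = 1) {h : A} (hh : h ^ 4 = c) {g : A}
    (hg : g ^ 2 = c) (a : F) : IsUnitNorm (1 + trace F A (single g a)) := by
  have h2 : (2 : MonoidAlgebra F A) = 0 := CharTwo.two_eq_zero
  obtain ⟨e, rfl⟩ : ∃ e, g = e * h ^ 2 := ⟨g * (h ^ 2)⁻¹, by simp⟩
  have he : e ^ 2 = 1 := by
    rw [mul_pow, ← pow_mul, hh] at hg
    simpa using hg
  set C : MonoidAlgebra F A := single c 1 with hC
  set H : MonoidAlgebra F A := single h 1 with hH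
  set H' : MonoidAlgebra F A := single h⁻¹ 1 with hH'
  set E : MonoidAlgebra F A := single e 1 with hE
  set L : MonoidAlgebra F A := single 1 a with hL
  have rH : H * H' = 1 := by rw [hH, hH', single_mul_single]; simp [one_def]
  have rE : E ^ 2 = 1 := by rw [hE, single_pow, he]; simp [one_def]
  have rC : H ^ 4 = C := by rw [hH, single_pow, hh]; simp [hC]
  have rC2 : C ^ 2 = 1 := by rw [hC, single_pow, hc]; simp [one_def]
  have iL : involution L = L := by rw [hL, involution_single, inv_one]
  have iE : involution E = E := by rw [hE, involution_single, inv_eq_iff_sq.2 he]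
  have iH : involution H = H' := by rw [hH, involution_single]
  have dd : (1 + C) * (1 + C) = 0 := one_add_single_sq hc
  have dC : (1 + C) * C = 1 + C := by linear_combination rC2
  have rH'2 : H' ^ 2 = C * H ^ 2 := by
    linear_combination (-H' ^ 2) * rC2 - C * H' ^ 2 * rC + C * H ^ 2 * (H * H' + 1) * rH
  have rH3 : H ^ 3 = C * H' := by
    linear_combination H' * rC - H ^ 3 * rH
  have rH'3 : H' ^ 3 = C * H := by
    linear_combination H' * rH'2 + C * H * rH
  have htr : trace F A (single (e * h ^ 2) a) = (1 + C) * (L * E * H ^ 2) := by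
    have : single (e * h ^ 2) a = L * E * H ^ 2 := by
      rw [hL, hE, hH, single_pow, single_mul_single, single_mul_single]; simp
    rw [this, trace_apply, sq H]
    simp only [involution_mul, iL, iE, iH]
    linear_combination L * E * rH'2
  set T : MonoidAlgebra F A := (L + L ^ 2 * E) * (H + H') with hT
  have hN1 : IsUnitNorm (1 + (1 + C) * (L * E * H ^ 2) + (1 + C) * T) := by
    refine ⟨1 + L * ((1 + H * H) * (E + H)), ?_, ?_⟩
    · simp only [map_add, map_mul, map_one, hH, hL, hE, augmentation_single]
      simp [CharTwo.add_self_eq_zero]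
    · simp only [involution_add, involution_mul, iL, iE, iH, involution_one]
      have f1 : (1 + H * H) * (1 + H' * H') = (1 + C) * H ^ 2 := by
        linear_combination h2 + rH'2 + (H * H' + 1) * rH
      have f2 : (E + H) * (E + H') = E * (H + H') := by
        linear_combination rE + rH + h2
      have f3 : (1 + H * H) * (E + H) + (1 + H' * H') * (E + H') =
          (1 + C) * (E * H ^ 2) + (1 + C) * (H + H') := by
        linear_combination E * h2 + E * rH'2 + rH3 + rH'3
      have f4 : (1 + C) * H ^ 2 * (E * (H + H')) = (1 + C) * (E * (H + H')) := by
        linear_combination (1 + C) * E * (rH3 + H * rH) + E * H' * dC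
      linear_combination L * f3 + L ^ 2 * (E + H) * (E + H') * f1 +
        L ^ 2 * (1 + C) * H ^ 2 * f2 + L ^ 2 * f4
  have hN2 : IsUnitNorm (1 + (1 + C) * T) := by
    have := isUnitNorm_one_add_single_mul_trace (F := F) hc (L * H + L ^ 2 * E * H)
    convert this using 3
    rw [trace_apply, sq L]
    simp only [involution_add, involution_mul, iL, iE, iH]
    ring
  convert hN1.mul hN2 using 1
  rw [htr]
  linear_combination -(1 + C) * T * h2 - (L * E * H ^ 2 * T + T ^ 2) * dd

end Norms

section Quotient

variable {F : Type*} [Field F] {A A' : Type*} [Group A] [Group A']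

theorem involution_mapDomainRingHom (π : A →* A') (x : MonoidAlgebra F A) :
    involution (mapDomainRingHom F π x) = mapDomainRingHom F π (involution x) := by
  induction x using MonoidAlgebra.induction_linear with
  | zero => simp [involution_zero]
  | add p q hp hq => rw [map_add, involution_add, involution_add, map_add, hp, hq]
  | single g a => simp [involution_single]

theorem trace_mapDomainRingHom (π : A →* A') (x : MonoidAlgebra F A) :
    trace F A' (mapDomainRingHom F π x) = mapDomainRingHom F π (trace F A x) := by
  rw [trace_apply, trace_apply, involution_mapDomainRingHom, map_add]

theorem augmentation_mapDomainRingHom (π : A →* A') (x : MonoidAlgebra F A) :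
    augmentation F A' (mapDomainRingHom F π x) = augmentation F A x := by
  induction x using MonoidAlgebra.induction_linear with
  | zero => simp
  | add p q hp hq => rw [map_add, map_add, map_add, hp, hq]
  | single g a => simp [augmentation_single]

variable {π : A →* A'}

theorem mapDomainRingHom_surjective (hπ : Function.Surjective π) :
    Function.Surjective (mapDomainRingHom F π) := by
  intro x
  induction x using MonoidAlgebra.induction_linear with
  | zero => exact ⟨0, map_zero _⟩
  | add p q hp hq =>
    obtain ⟨p, rfl⟩ := hp
    obtain ⟨q, rfl⟩ := hq
    exact ⟨p + q, map_add _ _ _⟩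
  | single g a =>
    obtain ⟨g, rfl⟩ := hπ g
    exact ⟨single g a, by simp⟩

theorem map_range_trace (hπ : Function.Surjective π) :
    (trace F A).range.map (mapDomainRingHom F π).toAddMonoidHom = (trace F A').range := by
  ext y
  simp only [AddSubgroup.mem_map, AddMonoidHom.mem_range]
  constructor
  · rintro ⟨_, ⟨x, rfl⟩, rfl⟩
    exact ⟨_, trace_mapDomainRingHom π x⟩
  · rintro ⟨y, rfl⟩
    obtain ⟨x, rfl⟩ := mapDomainRingHom_surjective hπ y
    exact ⟨_, ⟨x, rfl⟩, (trace_mapDomainRingHom π x).symm⟩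

end Quotient

section QuotientByTwo

variable {F : Type*} [Field F] {A A' : Type*} [CommGroup A] [CommGroup A'] {π : A →* A'}

variable [CharP F 2] {c : A}

theorem exists_of_mapDomainRingHom_eq_zero (hπ : Function.Surjective π)
    (hker : ∀ g, π g = 1 → g = 1 ∨ g = c) {x : MonoidAlgebra F A}
    (hx : mapDomainRingHom F π x = 0) : ∃ t, x = (1 + single c 1) * t := by
  obtain ⟨s, hs⟩ := hπ.hasRightInverse
  have key : ∀ x : MonoidAlgebra F A, ∃ t,
      x = mapDomain s (mapDomainRingHom F π x) + (1 + single c 1) * t := by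
    intro x
    induction x using MonoidAlgebra.induction_linear with
    | zero => exact ⟨0, by simp [mapDomain_zero]⟩
    | add p q hp hq =>
      obtain ⟨t, ht⟩ := hp
      obtain ⟨t', ht'⟩ := hq
      refine ⟨t + t', ?_⟩
      rw [map_add, mapDomain_add]
      nth_rw 1 [ht, ht']
      ring
    | single g a =>
      rw [mapDomainRingHom_apply, mapDomain_single, mapDomain_single]
      rcases hker (g * (s (π g))⁻¹) (by rw [map_mul, map_inv, hs, mul_inv_cancel]) with h | h
      · exact ⟨0, by rw [← mul_inv_eq_one.1 h]; simp⟩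
      · refine ⟨single (s (π g)) a, ?_⟩
        rw [add_mul, one_mul, single_mul_single, one_mul, ← add_assoc, CharTwo.add_self_eq_zero,
          zero_add, ← h, inv_mul_cancel_right]
  obtain ⟨t, ht⟩ := key x
  exact ⟨t, by rw [ht, hx, mapDomain_zero, zero_add]⟩

variable [Finite A]

theorem isUnitNorm_one_add_trace (hπ : Function.Surjective π)
    (hker : ∀ g, π g = 1 ↔ g = 1 ∨ g = c) (hc : c ^ 2 = 1) {h : A} (hh : h ^ 4 = c)
    {w : MonoidAlgebra F A} (hw : mapDomainRingHom F π (trace F A w) = 0) :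
    IsUnitNorm (1 + trace F A w) := by
  have : Finite A' := Finite.of_surjective π hπ
  have hdvd : ∀ {x : MonoidAlgebra F A}, mapDomainRingHom F π x = 0 →
      ∃ t, x = (1 + single c 1) * t :=
    exists_of_mapDomainRingHom_eq_zero hπ fun g => (hker g).1
  have hdd := one_add_single_sq (F := F) hc
  have hsym : ∀ {x : MonoidAlgebra F A}, involution (mapDomainRingHom F π x) =
      mapDomainRingHom F π x ↔ mapDomainRingHom F π (trace F A x) = 0 := by
    intro x
    rw [← trace_eq_zero_iff, trace_mapDomainRingHom]
  let H : AddSubmonoid (MonoidAlgebra F A') :=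
    { carrier := {y | involution y = y ∧
        ∃ x, mapDomainRingHom F π x = y ∧ IsUnitNorm (1 + trace F A x)}
      zero_mem' := ⟨involution_zero, 0, map_zero _, by
        rw [map_zero, add_zero]; exact IsUnitNorm.one⟩
      add_mem' := by
        rintro _ _ ⟨hx, x, rfl, hx'⟩ ⟨hy, y, rfl, hy'⟩
        refine ⟨by rw [involution_add, hx, hy], x + y, map_add _ _ _, ?_⟩
        obtain ⟨s, hs⟩ := hdvd (hsym.1 hx)
        obtain ⟨t, ht⟩ := hdvd (hsym.1 hy)
        convert hx'.mul hy' using 1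
        rw [map_add, hs, ht]
        linear_combination -(s * t) * hdd }
  have hH : mapDomainRingHom F π w ∈ H := by
    refine mem_of_involution_eq H ?_ ?_ (hsym.2 hw)
    · intro t
      obtain ⟨t, rfl⟩ := mapDomainRingHom_surjective hπ t
      refine ⟨involution_trace _, trace F A t, (trace_mapDomainRingHom π t).symm, ?_⟩
      rw [trace_eq_zero_iff.2 (involution_trace t), add_zero]
      exact IsUnitNorm.one
    · intro g a hg
      obtain ⟨g, rfl⟩ := hπ g
      refine ⟨trace_eq_zero_iff.1 (trace_single_of_sq hg a), single g a, by simp, ?_⟩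
      rcases (hker (g ^ 2)).1 (by rw [map_pow, hg]) with h1 | h1
      · rw [trace_single_of_sq h1, add_zero]
        exact IsUnitNorm.one
      · exact isUnitNorm_one_add_trace_single hc hh h1 a
  obtain ⟨-, x, hx, hx'⟩ := hH
  obtain ⟨q, hq⟩ := hdvd (x := w - x) (by rw [map_sub, hx, sub_self])
  obtain ⟨t, ht⟩ := hdvd (x := trace F A x) (by rw [← trace_mapDomainRingHom, hx,
    trace_mapDomainRingHom, hw])
  convert hx'.mul (isUnitNorm_one_add_single_mul_trace hc q) using 1
  rw [eq_add_of_sub_eq' hq, map_add, trace_one_add_single_mul hc, ht]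
  linear_combination -(t * trace F A q) * hdd

theorem map_normalizedUnits (hA : IsPGroup 2 A) (hπ : Function.Surjective π) :
    (normalizedUnits F A).map (Units.map (mapDomainRingHom F π : _ →* MonoidAlgebra F A')) =
      normalizedUnits F A' := by
  ext v
  rw [Subgroup.mem_map, mem_normalizedUnits]
  constructor
  · rintro ⟨u, hu, rfl⟩
    rw [mem_normalizedUnits] at hu
    rw [← hu]
    exact augmentation_mapDomainRingHom π _
  · intro hv
    obtain ⟨x, hx⟩ := mapDomainRingHom_surjective hπ (v : MonoidAlgebra F A')
    rw [← hx, augmentation_mapDomainRingHom] at hv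
    obtain ⟨u, rfl⟩ := isUnit_of_augmentation_ne_zero hA (x := x) (by simp [hv])
    exact ⟨u, mem_normalizedUnits.2 hv, Units.ext hx⟩

theorem map_normSubgroup (hA : IsPGroup 2 A) (hπ : Function.Surjective π) :
    (normSubgroup F A).map (Units.map (mapDomainRingHom F π : _ →* MonoidAlgebra F A')) =
      normSubgroup F A' := by
  rw [normSubgroup, normSubgroup, ← map_normalizedUnits hA hπ, Subgroup.map_map, Subgroup.map_map]
  congr 1
  refine MonoidHom.ext fun u => Units.ext ?_
  change mapDomainRingHom F π (_ * _) = mapDomainRingHom F π _ * involution (mapDomainRingHom F π _)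
  rw [map_mul, involution_mapDomainRingHom]
  rfl

/-- Passing to the quotient by a subgroup `{1, c}`, where `c` is a fourth power, does not change
the index of the group of norms in the group of all elements `1 + (t + t*)`. -/
theorem two_mul_card_normSubgroup_of_quotient (hA : IsPGroup 2 A) (hπ : Function.Surjective π)
    (hker : ∀ g, π g = 1 ↔ g = 1 ∨ g = c) (hc : c ^ 2 = 1) {h : A} (hh : h ^ 4 = c)
    (hA' : 2 * Nat.card (normSubgroup F A') = Nat.card (trace F A').range) :
    2 * Nat.card (normSubgroup F A) = Nat.card (trace F A).range := by
  rw [← card_map_mul_card_inf_ker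
      (Units.map (mapDomainRingHom F π : _ →* MonoidAlgebra F A')) (normSubgroup F A),
    ← card_map_mul_card_inf_ker' (mapDomainRingHom F π).toAddMonoidHom (trace F A).range,
    map_normSubgroup hA hπ, map_range_trace hπ, ← hA', mul_assoc]
  congr 2
  refine Nat.card_congr (Equiv.ofBijective (fun u => ⟨(u.1 : MonoidAlgebra F A) - 1, ?_, ?_⟩)
    ⟨fun u v huv => ?_, ?_⟩)
  · obtain ⟨x, hx, h1⟩ := (mem_normSubgroup_iff_isUnitNorm hA).1 u.2.1
    obtain ⟨t, ht⟩ := exists_mul_involution_eq x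
    refine ⟨t, ?_⟩
    rw [← h1, ht, hx, one_pow, map_one, add_sub_cancel_left]
  · have := Units.ext_iff.1 u.2.2
    change mapDomainRingHom F π (u.1 : MonoidAlgebra F A) = 1 at this
    change mapDomainRingHom F π _ = 0
    rw [map_sub, this, map_one, sub_self]
  · exact Subtype.ext (Units.ext (sub_left_injective (congrArg Subtype.val huv)))
  · rintro ⟨_, ⟨w, rfl⟩, hw⟩
    replace hw : mapDomainRingHom F π (trace F A w) = 0 := hw
    have hn := isUnitNorm_one_add_trace hπ hker hc hh hw
    obtain ⟨u, hu⟩ := isUnit_of_augmentation_ne_zero hA (x := 1 + trace F A w) (by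
      rw [trace_apply, map_add, map_add, augmentation_involution, CharTwo.add_self_eq_zero]
      simp)
    refine ⟨⟨u, (mem_normSubgroup_iff_isUnitNorm hA).2 (by rwa [hu]), Units.ext ?_⟩,
      Subtype.ext ?_⟩
    · change mapDomainRingHom F π (u : MonoidAlgebra F A) = 1
      rw [hu, map_add, hw, map_one, add_zero]
    · simp [hu]

end QuotientByTwo

/-- `G` is the union of the image of the abelian group `B` and its coset by `b`, where `b` inverts
`B` by conjugation and `b ^ 2` is the image of an element `z` with `z ^ 2 = 1`. -/
structure IsInvertingExtension {B G : Type*} [CommGroup B] [Group G] (i : B →* G) (b : G) (z : B) :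
    Prop where
  injective : Function.Injective i
  ne : ∀ g, i g ≠ b
  exists_eq : ∀ x, ∃ g, i g = x ∨ i g * b = x
  mul_eq : ∀ g, b * i g = i g⁻¹ * b
  sq_eq : b * b = i z
  sq_eq_one : z ^ 2 = 1

section Extension

variable {F : Type*} [Field F] {B G : Type*} [CommGroup B] [Group G] {i : B →* G} {b : G} {z : B}

namespace IsInvertingExtension

variable (h : IsInvertingExtension i b z)
include h

theorem bijective_elim : Function.Bijective (Sum.elim i fun g => i g * b) := by
  constructor
  · rintro (g | g) (g' | g') hg
    · exact congrArg _ (h.injective hg)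
    · refine absurd ?_ (h.ne (g'⁻¹ * g))
      change i g = i g' * b at hg
      rw [map_mul, hg, map_inv, inv_mul_cancel_left]
    · refine absurd ?_ (h.ne (g⁻¹ * g'))
      change i g * b = i g' at hg
      rw [map_mul, ← hg, map_inv, inv_mul_cancel_left]
    · exact congrArg _ (h.injective (mul_right_cancel hg))
  · intro x
    obtain ⟨g, hg | hg⟩ := h.exists_eq x
    · exact ⟨Sum.inl g, hg⟩
    · exact ⟨Sum.inr g, hg⟩

theorem card_eq [Finite B] : Nat.card G = 2 * Nat.card B := by
  rw [← Nat.card_congr (Equiv.ofBijective _ h.bijective_elim), Nat.card_sum, two_mul]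

theorem finite [Finite B] : Finite G :=
  Finite.of_surjective _ h.bijective_elim.surjective

theorem mul_self_eq (g : B) : i g * b * (i g * b) = i z := by
  rw [mul_assoc, ← mul_assoc b, h.mul_eq, mul_assoc, h.sq_eq, ← mul_assoc, ← map_mul,
    mul_inv_cancel, map_one, one_mul]

theorem card_involutionSet_eq [Finite B] :
    Nat.card (involutionSet G) = Nat.card (involutionSet B) + Nat.card {_g : B // z = 1} := by
  rw [← Nat.card_sum]
  let p : B ⊕ B → Prop := fun y => Sum.elim i (fun g => i g * b) y ^ 2 = 1
  have e1 : {y // p y} ≃ involutionSet G :=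
    Equiv.subtypeEquiv (Equiv.ofBijective _ h.bijective_elim) fun y => Iff.rfl
  have e2 : {g // p (Sum.inl g)} ≃ involutionSet B := Equiv.subtypeEquivRight fun g => by
    change i g ^ 2 = 1 ↔ g ^ 2 = 1
    rw [← map_pow, map_eq_one_iff i h.injective]
  have e3 : {g // p (Sum.inr g)} ≃ {_g : B // z = 1} := Equiv.subtypeEquivRight fun g => by
    change (i g * b) ^ 2 = 1 ↔ z = 1
    rw [sq, h.mul_self_eq, map_eq_one_iff i h.injective]
  exact Nat.card_congr (e1.symm.trans (Equiv.subtypeSum.trans (e2.sumCongr e3)))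

theorem card_involutionSet_of_eq_one [Finite B] (hz : z = 1) :
    Nat.card (involutionSet G) = Nat.card (involutionSet B) + Nat.card B := by
  rw [h.card_involutionSet_eq]
  congr 1
  exact Nat.card_congr (Equiv.subtypeUnivEquiv fun _ => hz)

theorem card_involutionSet_of_ne_one [Finite B] (hz : z ≠ 1) :
    Nat.card (involutionSet G) = Nat.card (involutionSet B) := by
  have : IsEmpty {_g : B // z = 1} := ⟨fun g => hz g.2⟩
  rw [h.card_involutionSet_eq, Nat.card_of_isEmpty (α := {_g : B // z = 1}), add_zero]

omit h in
variable (F i b) in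
/-- The map `(x, y) ↦ x + y b`. -/
noncomputable def pairMap (q : MonoidAlgebra F B × MonoidAlgebra F B) : MonoidAlgebra F G :=
  mapDomainRingHom F i q.1 + mapDomainRingHom F i q.2 * single b 1

theorem pairMap_bijective [Finite F] [Finite B] : Function.Bijective (pairMap F i b) := by
  refine Function.Surjective.bijective_of_nat_card_le ?_ ?_
  · intro x
    induction x using MonoidAlgebra.induction_linear with
    | zero => exact ⟨0, by simp [pairMap]⟩
    | add p q hp hq =>
      obtain ⟨p, rfl⟩ := hp
      obtain ⟨q, rfl⟩ := hq
      refine ⟨p + q, ?_⟩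
      simp only [pairMap, Prod.fst_add, Prod.snd_add, map_add]
      noncomm_ring
    | single g a =>
      obtain ⟨g, rfl | rfl⟩ := h.exists_eq g
      · exact ⟨(single g a, 0), by simp [pairMap]⟩
      · exact ⟨(0, single g a), by simp [pairMap, single_mul_single]⟩
  · have := h.finite
    rw [Nat.card_prod, card_monoidAlgebra, card_monoidAlgebra, h.card_eq, two_mul, pow_add]

theorem single_mul_mapDomainRingHom (x : MonoidAlgebra F B) :
    single b 1 * mapDomainRingHom F i x = mapDomainRingHom F i (involution x) * single b 1 := by
  induction x using MonoidAlgebra.induction_linear with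
  | zero => simp [involution_zero]
  | add p q hp hq => rw [map_add, mul_add, hp, hq, involution_add, map_add, add_mul]
  | single g a => simp [involution_single, single_mul_single, h.mul_eq]

theorem involution_pairMap (q : MonoidAlgebra F B × MonoidAlgebra F B) :
    involution (pairMap F i b q) = pairMap F i b (involution q.1, single z 1 * q.2) := by
  have hb : b⁻¹ = i z * b := by
    rw [inv_eq_iff_mul_eq_one, ← mul_assoc, h.mul_eq, inv_eq_iff_sq.2 h.sq_eq_one, mul_assoc,
      h.sq_eq, ← map_mul, ← sq, h.sq_eq_one, map_one]
  have hs : (single b⁻¹ 1 : MonoidAlgebra F G) =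
      mapDomainRingHom F i (single z 1) * single b 1 := by
    simp [hb, single_mul_single]
  rw [pairMap, pairMap, involution_add, involution_mul, involution_single, hs,
    involution_mapDomainRingHom, involution_mapDomainRingHom, mul_assoc,
    h.single_mul_mapDomainRingHom, involution_involution, ← mul_assoc, ← map_mul]

/-- In terms of `u = x + y b`, the product `u u*` is
`(x x* + y y*) + (1 + z) x y b`. -/
theorem pairMap_mul_involution (q : MonoidAlgebra F B × MonoidAlgebra F B) :
    pairMap F i b q * involution (pairMap F i b q) =
      pairMap F i b (q.1 * involution q.1 + q.2 * involution q.2,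
        (1 + single z 1) * (q.1 * q.2)) := by
  have hz : involution (single z 1 : MonoidAlgebra F B) = single z 1 := by
    rw [involution_single, inv_eq_iff_sq.2 h.sq_eq_one]
  have hb : (single b 1 * single b 1 : MonoidAlgebra F G) =
      mapDomainRingHom F i (single z 1) := by
    simp [single_mul_single, h.sq_eq]
  have hzz : (single z 1 * single z 1 : MonoidAlgebra F B) = 1 := by
    rw [single_mul_single, ← sq, h.sq_eq_one, one_mul, one_def]
  rw [h.involution_pairMap]
  simp only [pairMap, mul_add, add_mul]
  rw [← mul_assoc _ _ (single b 1), ← mul_assoc (mapDomainRingHom F i q.2 * _),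
    mul_assoc _ (single b 1), mul_assoc _ (single b 1), h.single_mul_mapDomainRingHom, h.single_mul_mapDomainRingHom,
    ← mul_assoc, ← mul_assoc _ _ (single b 1), mul_assoc _ (single b 1) (single b 1), hb]
  simp only [← map_mul, involution_mul, hz, involution_involution]
  have e1 : q.2 * (involution q.2 * single z 1) * single z 1 = q.2 * involution q.2 := by
    rw [mul_assoc, mul_assoc, hzz, mul_one]
  rw [e1, one_mul, map_add, map_add, add_mul, mul_left_comm, mul_comm q.2 q.1]
  abel

omit h in
theorem augmentation_pairMap (q : MonoidAlgebra F B × MonoidAlgebra F B) :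
    augmentation F G (pairMap F i b q) = augmentation F B q.1 + augmentation F B q.2 := by
  rw [pairMap, map_add, map_mul, augmentation_mapDomainRingHom, augmentation_mapDomainRingHom,
    augmentation_single, mul_one]

theorem card_unitarySubgroup [CharP F 2] [Finite F] [Finite B] :
    Nat.card (unitarySubgroup F G) = Nat.card {q : MonoidAlgebra F B × MonoidAlgebra F B //
      q.1 * involution q.1 + q.2 * involution q.2 = 1 ∧ (1 + single z 1) * (q.1 * q.2) = 0} := by
  have := h.finite
  rw [card_unitarySubgroup_eq]
  refine (Nat.card_congr (Equiv.subtypeEquiv (Equiv.ofBijective _ h.pairMap_bijective)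
    fun q => ?_)).symm
  have h1 : (1 : MonoidAlgebra F G) = pairMap F i b (1, 0) := by simp [pairMap]
  rw [Equiv.ofBijective_apply, h.pairMap_mul_involution, h1, h.pairMap_bijective.injective.eq_iff,
    Prod.mk.injEq, iff_and_self]
  rintro ⟨h2, -⟩
  have h3 := congrArg (augmentation F B) h2
  rw [map_add, map_mul, map_mul, augmentation_involution, augmentation_involution, map_one, ← sq,
    ← sq, ← CharTwo.add_sq, ← sub_eq_zero, CharTwo.sub_eq_add, ← one_pow 2, ← CharTwo.add_sq,
    sq_eq_zero_iff, CharTwo.add_eq_zero] at h3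
  rw [augmentation_pairMap, h3]

end IsInvertingExtension

end Extension

section Count

variable {F : Type*} [Field F] {B : Type*} [CommGroup B]

theorem trace_involution_mul (x y : MonoidAlgebra F B) :
    trace F B (x * involution y) = x * involution y + y * involution x := by
  rw [trace_apply, involution_mul, involution_involution]

variable [CharP F 2] [Finite B]

/-- The substitution `s = x + y`, `w = s y*` turns `x x* + y y* = 1` into `s s* + w + w* = 1`, whose
solutions for a given `s` of augmentation one form a coset of the symmetric elements. -/
theorem card_norm_add_norm_eq_one (hB : IsPGroup 2 B) :
    Nat.card {q : MonoidAlgebra F B × MonoidAlgebra F B //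
      q.1 * involution q.1 + q.2 * involution q.2 = 1} =
    Nat.card {x : MonoidAlgebra F B // augmentation F B x = 1} * Nat.card (trace F B).ker := by
  have hex : ∀ s : MonoidAlgebra F B, ∃ t, augmentation F B s = 1 →
      trace F B t = 1 + s * involution s := by
    intro s
    obtain ⟨t, ht⟩ := exists_mul_involution_eq s
    refine ⟨t, fun hs => ?_⟩
    rw [ht, hs, one_pow, map_one, ← add_assoc, CharTwo.add_self_eq_zero, zero_add]
  choose t ht using hex
  have hinv : ∀ s : MonoidAlgebra F B, augmentation F B s = 1 → s * Ring.inverse s = 1 :=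
    fun s hs => Ring.mul_inverse_cancel s (isUnit_of_augmentation_ne_zero hB (by simp [hs]))
  have hnorm : ∀ x y : MonoidAlgebra F B, x * involution x + y * involution y =
      (x + y) * involution (x + y) + trace F B ((x + y) * involution y) := by
    intro x y
    rw [trace_involution_mul, involution_add]
    linear_combination (-(x * involution y + y * involution x + y * involution y)) *
      CharTwo.two_eq_zero (R := MonoidAlgebra F B)
  have haug : ∀ x y : MonoidAlgebra F B, x * involution x + y * involution y = 1 →
      augmentation F B (x + y) = 1 := by
    intro x y h
    rw [hnorm] at h
    have h3 := congrArg (augmentation F B) h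
    rw [map_add, trace_apply, map_add, augmentation_involution, CharTwo.add_self_eq_zero, add_zero,
      map_mul, augmentation_involution, map_one, ← sq] at h3
    rw [← CharTwo.add_eq_zero, ← sq_eq_zero_iff, CharTwo.add_sq, h3, one_pow,
      CharTwo.add_self_eq_zero]
  rw [← Nat.card_prod]
  refine Nat.card_congr
    { toFun := fun q => (⟨q.1.1 + q.1.2, haug _ _ q.2⟩,
        ⟨(q.1.1 + q.1.2) * involution q.1.2 + t (q.1.1 + q.1.2), ?_⟩)
      invFun := fun r =>
        ⟨(r.1.1 + involution (Ring.inverse r.1.1 * (r.2.1 + t r.1.1)),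
          involution (Ring.inverse r.1.1 * (r.2.1 + t r.1.1))), ?_⟩
      left_inv := ?_
      right_inv := ?_ }
  · rw [AddMonoidHom.mem_ker, map_add, ht _ (haug _ _ q.2)]
    have := q.2
    rw [hnorm] at this
    rw [← add_assoc, add_right_comm, add_comm (trace F B _), this, CharTwo.add_self_eq_zero]
  · obtain ⟨⟨s, hs⟩, ⟨k, hk⟩⟩ := r
    rw [AddMonoidHom.mem_ker] at hk
    simp only
    rw [hnorm, add_assoc s, CharTwo.add_self_eq_zero, add_zero, involution_involution,
      ← mul_assoc, hinv s hs, one_mul, map_add, hk, zero_add, ht s hs, add_left_comm,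
      CharTwo.add_self_eq_zero, add_zero]
  · rintro ⟨⟨x, y⟩, h⟩
    have key : involution (Ring.inverse (x + y) * ((x + y) * involution y + t (x + y) + t (x + y))) =
        y := by
      rw [add_assoc, CharTwo.add_self_eq_zero, add_zero, ← mul_assoc, mul_comm (Ring.inverse _),
        hinv _ (haug _ _ h), one_mul, involution_involution]
    simp only [key, Subtype.mk.injEq, Prod.mk.injEq, and_true]
    rw [add_assoc, CharTwo.add_self_eq_zero, add_zero]
  · rintro ⟨⟨s, hs⟩, ⟨k, hk⟩⟩
    have key : s + involution (Ring.inverse s * (k + t s)) +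
        involution (Ring.inverse s * (k + t s)) = s := by
      rw [add_assoc, CharTwo.add_self_eq_zero, add_zero]
    simp only [key, Prod.mk.injEq, Subtype.mk.injEq, true_and]
    rw [involution_involution, ← mul_assoc, hinv s hs, one_mul, add_assoc,
      CharTwo.add_self_eq_zero, add_zero]

/-- In a solution of `x x* + y y* = 1`, `(1 + z) x y = 0`, exactly one of `x` and `y` is a unit;
that one is unitary, and the other one is annihilated by `1 + z`. -/
theorem card_norm_add_norm_eq_one_and [Finite F] (hB : IsPGroup 2 B) {z : B} (hz : z ^ 2 = 1)
    (hz1 : z ≠ 1) :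
    Nat.card {q : MonoidAlgebra F B × MonoidAlgebra F B //
      q.1 * involution q.1 + q.2 * involution q.2 = 1 ∧ (1 + single z 1) * (q.1 * q.2) = 0} =
    2 * (Nat.card (unitarySubgroup F B) *
      Nat.card {x : MonoidAlgebra F B // (1 + single z 1) * x = 0}) := by
  have hdd := one_add_single_sq (F := F) hz
  have hid := involution_one_add_single (F := F) hz
  set d : MonoidAlgebra F B := 1 + single z 1 with hd
  have hunit : ∀ {x y : MonoidAlgebra F B}, augmentation F B x ≠ 0 → d * (x * y) = 0 →
      d * y = 0 := by
    intro x y hx h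
    rw [mul_left_comm] at h
    exact ((isUnit_of_augmentation_ne_zero hB hx).mul_right_eq_zero).1 h
  have hann : ∀ {y : MonoidAlgebra F B}, d * y = 0 →
      augmentation F B y = 0 ∧ y * involution y = 0 := by
    intro y hy
    obtain ⟨t, rfl⟩ := exists_of_one_add_single_mul_eq_zero hz hz1 hy
    constructor
    · rw [map_mul, map_add, map_one, augmentation_single, CharTwo.add_self_eq_zero, zero_mul]
    · rw [involution_mul, hid]
      linear_combination (t * involution t) * hdd
  have hcase : ∀ {x y : MonoidAlgebra F B}, x * involution x + y * involution y = 1 →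
      d * (x * y) = 0 → augmentation F B x ≠ 0 →
      (augmentation F B x = 1 ∧ x * involution x = 1) ∧ d * y = 0 := by
    intro x y h h' hx
    have hy := hunit hx h'
    rw [(hann hy).2, add_zero] at h
    refine ⟨⟨?_, h⟩, hy⟩
    have h3 := congrArg (augmentation F B) h
    rw [map_mul, augmentation_involution, map_one, ← sq] at h3
    rw [← CharTwo.add_eq_zero, ← sq_eq_zero_iff, CharTwo.add_sq, h3, one_pow,
      CharTwo.add_self_eq_zero]
  rw [card_unitarySubgroup_eq, ← Nat.card_prod, two_mul, ← Nat.card_sum]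
  refine (Nat.card_congr (Equiv.ofBijective (Sum.elim
    (fun r => ⟨(r.1.1, r.2.1), by rw [r.1.2.2, (hann r.2.2).2, add_zero],
      by rw [mul_left_comm, r.2.2, mul_zero]⟩)
    (fun r => ⟨(r.2.1, r.1.1), by rw [r.1.2.2, (hann r.2.2).2, zero_add],
      by rw [← mul_assoc, r.2.2, zero_mul]⟩)) ⟨?_, ?_⟩)).symm
  · rintro (⟨⟨x, hx⟩, ⟨y, hy⟩⟩ | ⟨⟨x, hx⟩, ⟨y, hy⟩⟩)
      (⟨⟨x', hx'⟩, ⟨y', hy'⟩⟩ | ⟨⟨x', hx'⟩, ⟨y', hy'⟩⟩) h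
    · simp_all
    · simp only [Sum.elim_inl, Sum.elim_inr, Subtype.mk.injEq, Prod.mk.injEq] at h
      have := (hann hy').1
      rw [← h.1, hx.1] at this
      exact absurd this one_ne_zero
    · simp only [Sum.elim_inl, Sum.elim_inr, Subtype.mk.injEq, Prod.mk.injEq] at h
      have := (hann hy').1
      rw [← h.2, hx.1] at this
      exact absurd this one_ne_zero
    · simp_all
  · rintro ⟨⟨x, y⟩, h, h'⟩
    by_cases hx : augmentation F B x = 0
    · have hy : augmentation F B y ≠ 0 := by
        intro hy
        have h3 := congrArg (augmentation F B) h
        simp [hx, hy] at h3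
      obtain ⟨h1, h2⟩ := hcase ((add_comm _ _).trans h) (by rwa [mul_comm y x]) hy
      exact ⟨Sum.inr (⟨y, h1⟩, ⟨x, h2⟩), rfl⟩
    · obtain ⟨h1, h2⟩ := hcase h h' hx
      exact ⟨Sum.inl (⟨x, h1⟩, ⟨y, h2⟩), rfl⟩

end Count

section Order

variable {F : Type*} [Field F] [Finite F] {B G : Type*} [CommGroup B] [Group G]
  [Finite B] {i : B →* G} {b : G} {z : B}

theorem eq_pow_sub_one_of_card_mul {n x y : ℕ} (hn : 0 < n)
    (h : Nat.card F * x = y * Nat.card F ^ n) : x = y * Nat.card F ^ (n - 1) := by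
  obtain ⟨k, rfl⟩ := Nat.exists_eq_add_of_lt hn
  apply Nat.eq_of_mul_eq_mul_left (Nat.card_pos (α := F))
  rw [h, show 0 + k + 1 - 1 = k by omega]
  ring

variable [CharP F 2]

theorem IsInvertingExtension.card_unitarySubgroup_of_eq_one (h : IsInvertingExtension i b z)
    (hB : IsPGroup 2 B) (hz : z = 1) :
    Nat.card (unitarySubgroup F G) =
      Nat.card F ^ ((Nat.card G + Nat.card (involutionSet G)) / 2 - 1) := by
  obtain ⟨n, h1, h2⟩ := card_ker_trace F B
  have h3 := card_norm_add_norm_eq_one (F := F) hB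
  have hpos : 0 < Nat.card B := Nat.card_pos
  have hz0 : (1 + single z 1 : MonoidAlgebra F B) = 0 := by
    rw [hz, ← one_def, CharTwo.add_self_eq_zero]
  rw [← one_mul (_ ^ _)]
  apply eq_pow_sub_one_of_card_mul (by rw [h.card_eq]; omega)
  rw [h.card_unitarySubgroup]
  simp only [hz0, zero_mul, and_true]
  rw [h3, ← mul_assoc, card_augmentation_eq_one, card_monoidAlgebra, h2, ← pow_add, one_mul,
    h.card_eq, h.card_involutionSet_of_eq_one hz]
  congr 1
  omega

theorem IsInvertingExtension.card_unitarySubgroup_of_ne_one (h : IsInvertingExtension i b z)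
    (hB : IsPGroup 2 B) (hz : z ≠ 1)
    (hU : Nat.card F * Nat.card (unitarySubgroup F B) = 2 * Nat.card (trace F B).ker) :
    Nat.card (unitarySubgroup F G) =
      4 * Nat.card F ^ ((Nat.card G + Nat.card (involutionSet G)) / 2 - 1) := by
  obtain ⟨n, h1, h2⟩ := card_ker_trace F B
  obtain ⟨k, h3, h4⟩ := card_one_add_single_mul_eq_zero (F := F) h.sq_eq_one hz
  have hpos : 0 < Nat.card B := Nat.card_pos
  apply eq_pow_sub_one_of_card_mul (by rw [h.card_eq]; omega)
  rw [h.card_unitarySubgroup, card_norm_add_norm_eq_one_and hB h.sq_eq_one hz, mul_left_comm,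
    ← mul_assoc (Nat.card F), hU, h2, h4, mul_assoc, ← pow_add, ← mul_assoc, h.card_eq,
    h.card_involutionSet_of_ne_one hz]
  congr 2
  omega

/-- The order of the unitary subgroup when `b` has order four and `A` is generated by `b` and
elements of order at most two. -/
theorem card_unitarySubgroup_of_sq {A : Type*} [CommGroup A] [Finite A] {b : A} (hb : b ^ 4 = 1)
    (hb2 : b ^ 2 ≠ 1) (hA : ∀ x : A, x ^ 2 = 1 ∨ (x * b⁻¹) ^ 2 = 1) :
    Nat.card F * Nat.card (unitarySubgroup F A) = 2 * Nat.card (trace F A).ker := by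
  let B : Subgroup A := (powMonoidHom 2).ker
  have hB2 : ∀ g : B, g ^ 2 = 1 := fun g => Subtype.ext g.2
  let z : B := ⟨b ^ 2, by rw [MonoidHom.mem_ker, powMonoidHom_apply, ← pow_mul, hb]⟩
  have hz : z ≠ 1 := fun h => hb2 (congrArg Subtype.val h)
  have hB : IsPGroup 2 B := fun g => ⟨1, hB2 g⟩
  have h : IsInvertingExtension B.subtype b z :=
    { injective := Subtype.val_injective
      ne := fun g hg => hb2 (by rw [← hg]; exact g.2)
      exists_eq := fun x => by
        rcases hA x with hx | hx
        · exact ⟨⟨x, hx⟩, Or.inl rfl⟩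
        · exact ⟨⟨x * b⁻¹, hx⟩, Or.inr (by simp)⟩
      mul_eq := fun g => by rw [inv_eq_iff_sq.2 (hB2 g), mul_comm]
      sq_eq := (sq b).symm
      sq_eq_one := hB2 z }
  have hT : Nat.card (involutionSet B) = Nat.card B :=
    Nat.card_congr (Equiv.subtypeUnivEquiv hB2)
  obtain ⟨k, h3, h4⟩ := card_one_add_single_mul_eq_zero (F := F) h.sq_eq_one hz
  obtain ⟨n, h1, h2⟩ := card_ker_trace F A
  have hV : Nat.card (unitarySubgroup F B) =
      Nat.card {x : MonoidAlgebra F B // augmentation F B x = 1} := by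
    rw [card_unitarySubgroup_eq]
    refine Nat.card_congr (Equiv.subtypeEquivRight fun x => and_iff_left_of_imp fun hx => ?_)
    have hi : ∀ t : MonoidAlgebra F B, trace F B t = 0 := fun t => by
      induction t using MonoidAlgebra.induction_linear with
      | zero => exact map_zero _
      | add p q hp hq => rw [map_add, hp, hq, add_zero]
      | single g a => exact trace_single_of_sq (hB2 g) a
    obtain ⟨t, ht⟩ := exists_mul_involution_eq x
    rw [ht, hi, hx, one_pow, map_one, add_zero]
  rw [h.card_unitarySubgroup, card_norm_add_norm_eq_one_and hB h.sq_eq_one hz, mul_left_comm,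
    ← mul_assoc (Nat.card F), hV, card_augmentation_eq_one, card_monoidAlgebra, h4, h2, ← pow_add]
  rw [h.card_eq, h.card_involutionSet_of_ne_one hz, hT] at h1
  rw [h.card_involutionSet_of_ne_one hz, hT]
  congr 2
  omega

end Order

section CyclicTimesElementary

variable {E : Type*} [CommGroup E]

theorem isPGroup_cyclic_prod (hE : ∀ e : E, e ^ 2 = 1) {N k : ℕ} (hN : N = 2 ^ k) :
    IsPGroup 2 (Multiplicative (ZMod N) × E) := by
  rintro ⟨g, e⟩
  refine ⟨k + 1, Prod.ext ?_ ?_⟩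
  · apply Multiplicative.toAdd.injective
    change 2 ^ (k + 1) • g.toAdd = 0
    rw [pow_succ, ← hN, mul_nsmul', ZModModule.char_nsmul_eq_zero]
  · change e ^ 2 ^ (k + 1) = 1
    rw [pow_succ', pow_mul, hE, one_pow]

variable [Finite E] (F : Type*) [Field F] [Finite F] [CharP F 2]

theorem two_mul_card_normSubgroup_cyclic_prod (hE : ∀ e : E, e ^ 2 = 1) (k : ℕ) :
    2 * Nat.card (normSubgroup F (Multiplicative (ZMod (2 ^ (k + 2))) × E)) =
      Nat.card (trace F (Multiplicative (ZMod (2 ^ (k + 2))) × E)).range := by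
  induction k with
  | zero =>
    rw [two_mul_card_normSubgroup_iff (isPGroup_cyclic_prod hE rfl)]
    have h4 : (Multiplicative.ofAdd 1 : Multiplicative (ZMod (2 ^ (0 + 2)))) ^ 4 = 1 := by decide
    have h2 : (Multiplicative.ofAdd 1 : Multiplicative (ZMod (2 ^ (0 + 2)))) ^ 2 ≠ 1 := by decide
    apply card_unitarySubgroup_of_sq (b := (Multiplicative.ofAdd 1, 1))
    · exact Prod.ext h4 (one_pow _)
    · exact fun h => h2 (congrArg Prod.fst h)
    · rintro ⟨g, e⟩
      have key : ∀ g : Multiplicative (ZMod (2 ^ (0 + 2))),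
          g ^ 2 = 1 ∨ (g * (Multiplicative.ofAdd 1)⁻¹) ^ 2 = 1 := by decide
      rcases key g with h | h
      · exact Or.inl (Prod.ext h (hE e))
      · exact Or.inr (Prod.ext h (hE _))
  | succ k ih =>
    let f : ZMod (2 ^ (k + 1 + 2)) →+ ZMod (2 ^ (k + 2)) :=
      (ZMod.castHom (pow_dvd_pow 2 (by omega)) (ZMod (2 ^ (k + 2)))).toAddMonoidHom
    have hf : ∀ x, f x = 0 ↔ x = 0 ∨ x = ((2 ^ (k + 2) : ℕ) : ZMod (2 ^ (k + 1 + 2))) := by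
      intro x
      obtain ⟨n, hn, rfl⟩ : ∃ n : ℕ, n < 2 ^ (k + 1 + 2) ∧ (n : ZMod (2 ^ (k + 1 + 2))) = x :=
        ⟨x.val, ZMod.val_lt x, ZMod.natCast_zmod_val x⟩
      have h1 : f n = n := map_natCast (ZMod.castHom (pow_dvd_pow 2 (by omega)) _) n
      rw [h1, ZMod.natCast_eq_zero_iff, ZMod.natCast_eq_zero_iff, ZMod.natCast_eq_natCast_iff',
        Nat.mod_eq_of_lt hn, Nat.mod_eq_of_lt (Nat.pow_lt_pow_right one_lt_two (by omega))]
      constructor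
      · rintro ⟨d, rfl⟩
        have : d < 2 := by
          rw [show k + 1 + 2 = k + 2 + 1 by ring, pow_succ] at hn
          exact lt_of_mul_lt_mul_left hn (Nat.zero_le _)
        interval_cases d
        · exact Or.inl (by simp)
        · exact Or.inr (mul_one _)
      · rintro (h | rfl)
        · exact (pow_dvd_pow 2 (by omega)).trans h
        · exact dvd_rfl
    refine two_mul_card_normSubgroup_of_quotient
      (π := (AddMonoidHom.toMultiplicative f).prodMap (MonoidHom.id E))
      (c := (Multiplicative.ofAdd ((2 ^ (k + 2) : ℕ) : ZMod (2 ^ (k + 1 + 2))), 1))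
      (h := (Multiplicative.ofAdd ((2 ^ k : ℕ) : ZMod (2 ^ (k + 1 + 2))), 1))
      (isPGroup_cyclic_prod hE rfl) ?_ ?_ ?_ ?_ ih
    · exact Function.Surjective.prodMap
        (ZMod.castHom_surjective (pow_dvd_pow 2 (by omega : k + 2 ≤ k + 1 + 2)))
        Function.surjective_id
    · rintro ⟨g, e⟩
      have := hf g.toAdd
      constructor
      · intro h
        have h1 : f g.toAdd = 0 := congrArg Prod.fst h
        have h2 : e = 1 := congrArg Prod.snd h
        rcases this.1 h1 with h3 | h3
        · exact Or.inl (Prod.ext h3 h2)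
        · exact Or.inr (Prod.ext h3 h2)
      · rintro (h | h)
        · exact Prod.ext (this.2 (Or.inl (congrArg Prod.fst h))) (congrArg Prod.snd h :)
        · exact Prod.ext (this.2 (Or.inr (congrArg Prod.fst h))) (congrArg Prod.snd h :)
    · refine Prod.ext (Multiplicative.toAdd.injective ?_) (one_pow _)
      change 2 • ((2 ^ (k + 2) : ℕ) : ZMod (2 ^ (k + 1 + 2))) = 0
      rw [nsmul_eq_mul, ← Nat.cast_mul, ZMod.natCast_eq_zero_iff]
      exact dvd_of_eq (by ring)
    · refine Prod.ext (Multiplicative.toAdd.injective ?_) (one_pow _)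
      change 4 • ((2 ^ k : ℕ) : ZMod (2 ^ (k + 1 + 2))) = ((2 ^ (k + 2) : ℕ) : _)
      rw [nsmul_eq_mul, ← Nat.cast_mul]
      congr 1
      ring

theorem card_unitarySubgroup_cyclic_prod (hE : ∀ e : E, e ^ 2 = 1) {N k : ℕ}
    (hN : N = 2 ^ (k + 2)) :
    Nat.card F * Nat.card (unitarySubgroup F (Multiplicative (ZMod N) × E)) =
      2 * Nat.card (trace F (Multiplicative (ZMod N) × E)).ker := by
  subst hN
  exact (two_mul_card_normSubgroup_iff (isPGroup_cyclic_prod hE rfl)).1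
    (two_mul_card_normSubgroup_cyclic_prod F hE k)

end CyclicTimesElementary

section Models

variable {E : Type*} [CommGroup E]

theorem isInvertingExtension_dihedral (hE : ∀ e : E, e ^ 2 = 1) (n : ℕ) :
    ∃ i : Multiplicative (ZMod n) × E →* DihedralGroup n × E,
      IsInvertingExtension i (DihedralGroup.sr 0, 1) 1 := by
  let r : Multiplicative (ZMod n) →* DihedralGroup n :=
    { toFun := fun g => DihedralGroup.r g.toAdd
      map_one' := rfl
      map_mul' := fun g h => (DihedralGroup.r_mul_r _ _).symm }
  refine ⟨r.prodMap (MonoidHom.id E), ?_, ?_, ?_, ?_, ?_, one_pow 2⟩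
  · exact Function.Injective.prodMap (fun g h hgh => DihedralGroup.r.inj hgh) Function.injective_id
  · rintro ⟨g, e⟩ h
    exact DihedralGroup.noConfusion rfl (heq_of_eq (congrArg Prod.fst h))
  · rintro ⟨j | j, e⟩
    · exact ⟨(Multiplicative.ofAdd j, e), Or.inl rfl⟩
    · refine ⟨(Multiplicative.ofAdd (-j), e), Or.inr (Prod.ext ?_ (mul_one e))⟩
      change DihedralGroup.r (-j) * DihedralGroup.sr 0 = _
      simp
  · rintro ⟨g, e⟩
    refine Prod.ext ?_ ?_
    · change DihedralGroup.sr 0 * DihedralGroup.r g.toAdd =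
        DihedralGroup.r (-g.toAdd) * DihedralGroup.sr 0
      simp
    · change 1 * e = e⁻¹ * 1
      rw [one_mul, mul_one, inv_eq_iff_sq.2 (hE e)]
  · exact Prod.ext (DihedralGroup.sr_mul_self 0) (mul_one 1)

theorem isInvertingExtension_quaternion (hE : ∀ e : E, e ^ 2 = 1) (n : ℕ) :
    ∃ i : Multiplicative (ZMod (2 * n)) × E →* QuaternionGroup n × E,
      IsInvertingExtension i (QuaternionGroup.xa 0, 1)
        (Multiplicative.ofAdd (n : ZMod (2 * n)), 1) := by
  let r : Multiplicative (ZMod (2 * n)) →* QuaternionGroup n :=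
    { toFun := fun g => QuaternionGroup.a g.toAdd
      map_one' := rfl
      map_mul' := fun g h => (QuaternionGroup.a_mul_a _ _).symm }
  refine ⟨r.prodMap (MonoidHom.id E), ?_, ?_, ?_, ?_, ?_, ?_⟩
  · exact Function.Injective.prodMap (fun g h hgh => QuaternionGroup.a.inj hgh)
      Function.injective_id
  · rintro ⟨g, e⟩ h
    exact QuaternionGroup.noConfusion rfl (heq_of_eq (congrArg Prod.fst h))
  · rintro ⟨j | j, e⟩
    · exact ⟨(Multiplicative.ofAdd j, e), Or.inl rfl⟩
    · refine ⟨(Multiplicative.ofAdd (-j), e), Or.inr (Prod.ext ?_ (mul_one e))⟩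
      change QuaternionGroup.a (-j) * QuaternionGroup.xa 0 = _
      simp
  · rintro ⟨g, e⟩
    refine Prod.ext ?_ ?_
    · change QuaternionGroup.xa 0 * QuaternionGroup.a g.toAdd =
        QuaternionGroup.a (-g.toAdd) * QuaternionGroup.xa 0
      simp
    · change 1 * e = e⁻¹ * 1
      rw [one_mul, mul_one, inv_eq_iff_sq.2 (hE e)]
  · refine Prod.ext ?_ (mul_one 1)
    change QuaternionGroup.xa 0 * QuaternionGroup.xa 0 = QuaternionGroup.a (n : ZMod (2 * n))
    simp
  · refine Prod.ext (Multiplicative.toAdd.injective ?_) (one_pow 2)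
    change 2 • (n : ZMod (2 * n)) = 0
    rw [nsmul_eq_mul, ← Nat.cast_mul, ZMod.natCast_self]

end Models

end UnitaryGroupAlgebra

/-- `DihedralGroup n` has order `2 * n` and `QuaternionGroup n` has order `4 * n`, so that the two
groups below are the dihedral and the generalized quaternion group of order `2 ^ m`.
In both cases `|G|` and `|G_T|` are positive even numbers, so that the division by `2` and
the subtraction of `1` in the exponent are exact. -/
theorem corollary2p3 {F : Type*} [Field F] [Finite F] [CharP F 2]
    {E : Type*} [CommGroup E] [Finite E] (hE : ∀ e : E, e ^ 2 = 1)
    (m : ℕ) (hm : 2 < m) :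
    Nat.card (UnitaryGroupAlgebra.unitarySubgroup F (DihedralGroup (2 ^ (m - 1)) × E)) =
      Nat.card F ^ ((Nat.card (DihedralGroup (2 ^ (m - 1)) × E) +
        Nat.card (UnitaryGroupAlgebra.involutionSet (DihedralGroup (2 ^ (m - 1)) × E))) / 2 - 1) ∧
    Nat.card (UnitaryGroupAlgebra.unitarySubgroup F (QuaternionGroup (2 ^ (m - 2)) × E)) =
      4 * Nat.card F ^ ((Nat.card (QuaternionGroup (2 ^ (m - 2)) × E) +
        Nat.card (UnitaryGroupAlgebra.involutionSet (QuaternionGroup (2 ^ (m - 2)) × E))) / 2 - 1) := by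
  obtain ⟨k, rfl⟩ := Nat.exists_eq_add_of_lt hm
  constructor
  · obtain ⟨i, hi⟩ := UnitaryGroupAlgebra.isInvertingExtension_dihedral hE (2 ^ (2 + k + 1 - 1))
    have : Finite (Multiplicative (ZMod (2 ^ (2 + k + 1 - 1)))) :=
      inferInstanceAs (Finite (ZMod _))
    exact hi.card_unitarySubgroup_of_eq_one (UnitaryGroupAlgebra.isPGroup_cyclic_prod hE rfl) rfl
  · have hN : 2 * 2 ^ (2 + k + 1 - 2) = 2 ^ (k + 2) := by
      rw [show 2 + k + 1 - 2 = k + 1 by omega]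
      ring
    obtain ⟨i, hi⟩ := UnitaryGroupAlgebra.isInvertingExtension_quaternion hE (2 ^ (2 + k + 1 - 2))
    have : Finite (Multiplicative (ZMod (2 * 2 ^ (2 + k + 1 - 2)))) :=
      inferInstanceAs (Finite (ZMod _))
    refine hi.card_unitarySubgroup_of_ne_one (UnitaryGroupAlgebra.isPGroup_cyclic_prod hE hN) ?_
      (UnitaryGroupAlgebra.card_unitarySubgroup_cyclic_prod F hE hN)
    intro h
    have h1 : ((2 ^ (2 + k + 1 - 2) : ℕ) : ZMod (2 * 2 ^ (2 + k + 1 - 2))) = 0 :=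
      congrArg Prod.fst h
    rw [ZMod.natCast_eq_zero_iff] at h1
    have := Nat.le_of_dvd (by positivity) h1
    have : 0 < 2 ^ (2 + k + 1 - 2) := by positivity
    omega
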